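/- A finitely generated Hopf algebra is a pair $(A,u)$, where $A$ is a unital $C^*$-algebra and $u\in M_n(A)$ is a unitary whose entries generate $A$, such that $\Delta(u_{ij})=\sum_k u_{ik}\otimes u_{kj}$, $\varepsilon(u_{ij})=\delta_{ij}$ and $S(u_{ij})=u_{ji}^*$ define morphisms of unital $C^*$-algebras $\Delta:A\to A\otimes A$ (minimal tensor product), $\varepsilon:A\to\mathbb C$ and $S:A\to A^{op}$. A morphism $(A,u)\to(B,v)$ is a unital $*$-homomorphism $A_s\to B_s$, with $u_{ij}\mapsto v_{ij}$, between the dense $*$-subalgebras generated by the entries of $u$ and of $v$. Let $\bar u=(u_{ij}^*)$. For a word $\alpha=\alpha_1\cdots\alpha_k$ in two letters $a,b$ put $u^\alpha=u^{\alpha_1}\otimes\cdots\otimes u^{\alpha_k}$, with $u^a=u$ and $u^b=\bar u$, and let $Hom(u^\alpha,u^\beta)$ be the space of scalar matrices $T$ with $Tu^\alpha=u^\beta T$. Let $A_u(n)$ be the universal $C^*$-algebra generated by the entries of an $n\times n$ matrix $u$ such that $u$ and $u^t$ are unitaries, and let $A_s(n)$ be the universal $C^*$-algebra generated by the entries of an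 $n\times n$ magic matrix (i.e. $u=\bar u$, $u^t=u^{-1}$, distinct entries on the same row or column have product $0$, and all the entries are projections). Let $D_s(k,l)$ be the set of noncrossing pairings between an upper row of $2k$ points and a lower row of $2l$ points. A diagram in $D_s(k,l)$ acts as a linear map $(\mathbb C^n)^{\otimes k}\to(\mathbb C^n)^{\otimes l}$: number the points of each row $1,2,\ldots$ from left to right; given indices $i_1,\ldots,i_k$ and $j_1,\ldots,j_l$, label the upper points $2r-1,2r$ by $i_r$ and the lower points $2r-1,2r$ by $j_r$; then the $(j,i)$ matrix entry is $1$ if each string joins points with equal labels, and $0$ otherwise. The Hopf algebra $(A,u)$ is free if the canonical map $A_u(n)\to A_s(n)$ factorizes through $(A,u)$ (as morphisms in the above sense), and if for all words $\alpha,\beta$ the space $Hom(u^\alpha,u^\beta)$ is spanned by (the linear maps of) some subset of $D_s(|\alpha|,|\beta|)$. It is free orthogonal if moreover $u=\bar u$. The level of a free orthogonal Hopf algebra is the smallest $l\in\{0,1,\ldots,\infty\}$ such that $1\in u^{\otimes 2l+1}$, i.e. $Hom(1,u^{\otimes 2l+1})\neq 0$ (with $l=\infty$ if there is no such integer). Let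 $C(\mathbb T)*A$ be the full (unital) free product of $C^*$-algebras, let $z\in C(\mathbb T)$ be the identity function $z(x)=x$, and let $\tilde A\subset C(\mathbb T)*A$ be the $C^*$-subalgebra generated by the entries $zu_{ij}$ of the matrix $\tilde u=zu$. **Theorem 4.4.** If $(A,u)$ is a free orthogonal Hopf algebra of level $l<\infty$, then $\tilde A=C(\mathbb T)*A$. -/

import Mathlib

open scoped TensorProduct

noncomputable section

namespace FreeQG

universe u v w

/-! ### C*-seminorms and the C*-algebras obtained from them by separation and completion -/

/-- A C*-seminorm on a unital complex *-algebra. -/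
structure CStarSeminorm (P : Type u) [Ring P] [StarRing P] [Algebra ℂ P]
    extends Seminorm ℂ P where
  mul_le' : ∀ x y, toFun (x * y) ≤ toFun x * toFun y
  star_mul_self' : ∀ x, toFun (star x * x) = toFun x * toFun x

namespace CStarSeminorm

variable {P : Type u} [Ring P] [StarRing P] [Algebra ℂ P]

lemma mul_le (p : CStarSeminorm P) (x y : P) :
    p.toSeminorm (x * y) ≤ p.toSeminorm x * p.toSeminorm y := p.mul_le' x y

lemma star_mul_self (p : CStarSeminorm P) (x : P) :
    p.toSeminorm (star x * x) = p.toSeminorm x * p.toSeminorm x := p.star_mul_self' x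

lemma le_star (p : CStarSeminorm P) (x : P) : p.toSeminorm x ≤ p.toSeminorm (star x) := by
  have h1 := p.mul_le (star x) x
  rw [p.star_mul_self] at h1
  have h0 : 0 ≤ p.toSeminorm x := apply_nonneg _ _
  rcases h0.eq_or_lt with h | h
  · rw [← h]; exact apply_nonneg _ _
  · exact le_of_mul_le_mul_right h1 h

lemma star_eq (p : CStarSeminorm P) (x : P) : p.toSeminorm (star x) = p.toSeminorm x :=
  le_antisymm (by simpa using p.le_star (star x)) (p.le_star x)

lemma one_le (p : CStarSeminorm P) : p.toSeminorm 1 ≤ 1 := by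
  have h := p.star_mul_self 1
  simp only [star_one, mul_one] at h
  have h0 : 0 ≤ p.toSeminorm 1 := apply_nonneg _ _
  nlinarith

/-- The pointwise supremum of a pointwise bounded set of C*-seminorms. -/
def sup (S : Set (CStarSeminorm P))
    (hS : ∀ x, BddAbove (Set.range fun q : S => q.1.toSeminorm x)) : CStarSeminorm P where
  toFun x := ⨆ q : S, q.1.toSeminorm x
  map_zero' := by simp
  add_le' x y := by
    refine Real.iSup_le (fun q => ?_) (add_nonneg (Real.iSup_nonneg fun q => apply_nonneg _ _)
      (Real.iSup_nonneg fun q => apply_nonneg _ _))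
    exact (map_add_le_add _ _ _).trans (add_le_add (le_ciSup (hS x) q) (le_ciSup (hS y) q))
  neg' x := by simp
  smul' c x := by simp [map_smul_eq_mul, Real.mul_iSup_of_nonneg (norm_nonneg c)]
  mul_le' x y := by
    refine Real.iSup_le (fun q => ?_) (mul_nonneg (Real.iSup_nonneg fun q => apply_nonneg _ _)
      (Real.iSup_nonneg fun q => apply_nonneg _ _))
    exact (q.1.mul_le _ _).trans (mul_le_mul (le_ciSup (hS x) q) (le_ciSup (hS y) q)
      (apply_nonneg _ _) (Real.iSup_nonneg fun q => apply_nonneg _ _))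
  star_mul_self' x := by
    have h0 : 0 ≤ ⨆ q : S, q.1.toSeminorm x := Real.iSup_nonneg fun q => apply_nonneg _ _
    apply le_antisymm
    · refine Real.iSup_le (fun q => ?_) (mul_nonneg h0 h0)
      rw [q.1.star_mul_self]
      exact mul_le_mul (le_ciSup (hS x) q) (le_ciSup (hS x) q) (apply_nonneg _ _) h0
    · have h1 : 0 ≤ ⨆ q : S, q.1.toSeminorm (star x * x) :=
        Real.iSup_nonneg fun q => apply_nonneg _ _
      have h2 : (⨆ q : S, q.1.toSeminorm x) ≤ √(⨆ q : S, q.1.toSeminorm (star x * x)) := by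
        refine Real.iSup_le (fun q => Real.le_sqrt_of_sq_le ?_) (Real.sqrt_nonneg _)
        rw [sq, ← q.1.star_mul_self]
        exact le_ciSup (hS (star x * x)) q
      calc _ ≤ √(⨆ q : S, q.1.toSeminorm (star x * x)) * √(⨆ q : S, q.1.toSeminorm (star x * x)) :=
            mul_le_mul h2 h2 h0 (Real.sqrt_nonneg _)
        _ = _ := Real.mul_self_sqrt h1

/-- The algebra `P`, seen as a seminormed algebra through `p`. -/
def Space (_p : CStarSeminorm P) : Type u := P

variable (p : CStarSeminorm P)

instance : Ring p.Space := inferInstanceAs (Ring P)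
instance : StarRing p.Space := inferInstanceAs (StarRing P)
instance : Algebra ℂ p.Space := inferInstanceAs (Algebra ℂ P)
instance [StarModule ℂ P] : StarModule ℂ p.Space := inferInstanceAs (StarModule ℂ P)

/-- The identity map from `P` to its seminormed copy. -/
def toSpace : P →⋆ₐ[ℂ] p.Space where
  toFun x := x
  map_one' := rfl
  map_mul' _ _ := rfl
  map_zero' := rfl
  map_add' _ _ := rfl
  commutes' _ := rfl
  map_star' _ := rfl

instance : SeminormedRing p.Space where
  __ := (inferInstance : Ring p.Space)
  __ := p.toSeminorm.toAddGroupSeminorm.toSeminormedAddGroup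
  norm_mul_le x y := p.mul_le x y

lemma norm_toSpace (x : P) : ‖p.toSpace x‖ = p.toSeminorm x := rfl

instance : NormedAlgebra ℂ p.Space where
  norm_smul_le c x := (map_smul_eq_mul p.toSeminorm c x).le

lemma norm_star_space (x : p.Space) : ‖star x‖ = ‖x‖ := p.star_eq x

/-- The C*-algebra obtained from `P` and the C*-seminorm `p` by separation and completion
(`UniformSpace.Completion` is the Hausdorff completion). -/
def Completion : Type u := UniformSpace.Completion p.Space

instance : NormedRing p.Completion := inferInstanceAs (NormedRing (UniformSpace.Completion p.Space))
instance : CompleteSpace p.Completion :=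
  inferInstanceAs (CompleteSpace (UniformSpace.Completion p.Space))
instance : Algebra ℂ p.Completion :=
  inferInstanceAs (Algebra ℂ (UniformSpace.Completion p.Space))

instance : NormedAlgebra ℂ p.Completion where
  norm_smul_le := norm_smul_le (α := ℂ) (β := UniformSpace.Completion p.Space)

lemma uniformContinuous_star : UniformContinuous (star : p.Space → p.Space) :=
  (AddMonoidHomClass.isometry_of_norm (starAddEquiv : p.Space ≃+ p.Space)
    p.norm_star_space).uniformContinuous

instance : Star p.Completion := ⟨UniformSpace.Completion.map (star : p.Space → p.Space)⟩

/-- The canonical map from the seminormed algebra to its Hausdorff completion. -/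
def incl (x : p.Space) : p.Completion := UniformSpace.Completion.coe' x

lemma incl_mul (x y : p.Space) : p.incl (x * y) = p.incl x * p.incl y :=
  UniformSpace.Completion.coe_mul x y

lemma incl_add (x y : p.Space) : p.incl (x + y) = p.incl x + p.incl y :=
  UniformSpace.Completion.coe_add x y

lemma star_incl (x : p.Space) : star (p.incl x) = p.incl (star x) :=
  UniformSpace.Completion.map_coe p.uniformContinuous_star x

lemma denseRange_incl : DenseRange p.incl :=
  UniformSpace.Completion.denseRange_coe (α := p.Space)

lemma continuous_star : Continuous (star : p.Completion → p.Completion) :=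
  UniformSpace.Completion.continuous_map

instance : StarRing p.Completion where
  star_involutive x := by
    refine p.denseRange_incl.induction_on x
      (isClosed_eq (p.continuous_star.comp p.continuous_star) continuous_id) fun a => ?_
    rw [star_incl, star_incl, star_star]
  star_mul x y := by
    refine p.denseRange_incl.induction_on₂ (p := fun x y => star (x * y) = star y * star x)
      (isClosed_eq (p.continuous_star.comp (continuous_fst.mul continuous_snd))
        ((p.continuous_star.comp continuous_snd).mul (p.continuous_star.comp continuous_fst)))
      (fun a b => ?_) x y
    rw [← incl_mul, star_incl, star_incl, star_incl, star_mul, incl_mul]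
  star_add x y := by
    refine p.denseRange_incl.induction_on₂ (p := fun x y => star (x + y) = star x + star y)
      (isClosed_eq (p.continuous_star.comp (continuous_fst.add continuous_snd))
        ((p.continuous_star.comp continuous_fst).add (p.continuous_star.comp continuous_snd)))
      (fun a b => ?_) x y
    rw [← incl_add, star_incl, star_incl, star_incl, star_add, incl_add]

/-- The canonical *-homomorphism from `P` to its completion, with dense range. -/
def of : P →⋆ₐ[ℂ] p.Completion where
  toFun x := p.incl (p.toSpace x)
  map_one' := UniformSpace.Completion.coe_one p.Space
  map_mul' x y := p.incl_mul (p.toSpace x) (p.toSpace y)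
  map_zero' := UniformSpace.Completion.coe_zero
  map_add' x y := p.incl_add (p.toSpace x) (p.toSpace y)
  commutes' _ := rfl
  map_star' x := (p.star_incl (p.toSpace x)).symm

lemma norm_of (x : P) : ‖p.of x‖ = p.toSeminorm x :=
  UniformSpace.Completion.norm_coe (p.toSpace x)

lemma denseRange_of : DenseRange p.of :=
  UniformSpace.Completion.denseRange_coe (α := p.Space)

instance [StarModule ℂ P] : CStarAlgebra p.Completion where
  __ := (inferInstance : NormedRing p.Completion)
  __ := (inferInstance : StarRing p.Completion)
  __ := (inferInstance : NormedAlgebra ℂ p.Completion)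
  __ := (inferInstance : CompleteSpace p.Completion)
  norm_mul_self_le x := by
    refine p.denseRange_of.induction_on x
      (isClosed_le (by fun_prop) ((p.continuous_star.mul continuous_id).norm)) fun a => ?_
    rw [← map_star, ← map_mul, norm_of, norm_of, p.star_mul_self]
  star_smul c x := by
    refine p.denseRange_of.induction_on x
      (isClosed_eq (p.continuous_star.comp (continuous_const_smul c))
        (p.continuous_star.const_smul (star c))) fun a => ?_
    rw [← map_smul, ← map_star, star_smul, map_smul, map_star]

end CStarSeminorm

/-! ### Universal C*-algebras given by generators and relations -/

/-- The free unital complex *-algebra on a set `X`: the algebra of the monoid of words in the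
letters `x = (x, false)` and `x* = (x, true)`, for `x : X`. -/
abbrev FreeStarAlgebra (X : Type u) : Type u := MonoidAlgebra ℂ (FreeMonoid (X × Bool))

namespace FreeStarAlgebra

variable {X : Type u}

/-- The involution on words: reverse the word, and exchange each `x` with `x*`. -/
def starWord (w : FreeMonoid (X × Bool)) : FreeMonoid (X × Bool) :=
  star (FreeMonoid.map (fun l : X × Bool => (l.1, !l.2)) w)

lemma starWord_mul (w w' : FreeMonoid (X × Bool)) :
    starWord (w * w') = starWord w' * starWord w := by
  simp [starWord]

lemma starWord_starWord (w : FreeMonoid (X × Bool)) : starWord (starWord w) = w := by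
  induction w using FreeMonoid.inductionOn' with
  | one => simp [starWord]
  | of_mul x w ih =>
    rw [starWord_mul, starWord_mul, ih]
    simp [starWord]

/-- The involution is conjugate linear, and given by `starWord` on the words. -/
instance : Star (FreeStarAlgebra X) :=
  ⟨fun f => MonoidAlgebra.map (starRingEnd ℂ : ℂ →+ ℂ) (MonoidAlgebra.mapDomain starWord f)⟩

lemma star_single (w : FreeMonoid (X × Bool)) (c : ℂ) :
    star (MonoidAlgebra.single w c : FreeStarAlgebra X) =
      MonoidAlgebra.single (starWord w) (starRingEnd ℂ c) := by
  change MonoidAlgebra.map _ (MonoidAlgebra.mapDomain starWord _) = _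
  rw [MonoidAlgebra.mapDomain_single, MonoidAlgebra.map_single]
  rfl

lemma star_add' (f g : FreeStarAlgebra X) : star (f + g) = star f + star g := by
  change MonoidAlgebra.map _ (MonoidAlgebra.mapDomain starWord _) = _
  rw [MonoidAlgebra.mapDomain_add, MonoidAlgebra.map_add]
  rfl

lemma star_zero' : star (0 : FreeStarAlgebra X) = 0 := by
  change MonoidAlgebra.map _ (MonoidAlgebra.mapDomain starWord _) = _
  simp

instance : StarRing (FreeStarAlgebra X) where
  star_add := star_add'
  star_involutive f := by
    induction f using MonoidAlgebra.induction_linear with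
    | zero => rw [star_zero', star_zero']
    | add f g hf hg => rw [star_add', star_add', hf, hg]
    | single w c => rw [star_single, star_single, starWord_starWord, Complex.conj_conj]
  star_mul f g := by
    induction f using MonoidAlgebra.induction_linear with
    | zero => rw [zero_mul, star_zero', mul_zero]
    | add f f' hf hf' => rw [add_mul, star_add', star_add', mul_add, hf, hf']
    | single w c =>
      induction g using MonoidAlgebra.induction_linear with
      | zero => rw [mul_zero, star_zero', zero_mul]
      | add g g' hg hg' => rw [mul_add, star_add', star_add', add_mul, hg, hg']
      | single w' c' =>
        rw [MonoidAlgebra.single_mul_single, star_single, star_single, star_single,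
          MonoidAlgebra.single_mul_single, starWord_mul, map_mul, mul_comm]

instance : StarModule ℂ (FreeStarAlgebra X) where
  star_smul c f := by
    induction f using MonoidAlgebra.induction_linear with
    | zero => rw [smul_zero, star_zero', smul_zero]
    | add f g hf hg => rw [smul_add, star_add', star_add', smul_add, hf, hg]
    | single w d =>
      rw [MonoidAlgebra.smul_single, star_single, star_single, MonoidAlgebra.smul_single,
        smul_eq_mul, map_mul]
      rfl

/-- The generator attached to `x : X`. -/
def gen (x : X) : FreeStarAlgebra X := MonoidAlgebra.of ℂ _ (FreeMonoid.of (x, false))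

lemma star_gen (x : X) : star (gen x) = MonoidAlgebra.of ℂ _ (FreeMonoid.of (x, true)) := by
  simp [gen, MonoidAlgebra.of_apply, star_single, starWord]

end FreeStarAlgebra

open FreeStarAlgebra

/-- The C*-seminorms on the free *-algebra on `X` that vanish on the relations `R` and for which
each generator `x` has norm at most `c x`. -/
def relSeminorms {X : Type u} (c : X → ℝ) (R : Set (FreeStarAlgebra X)) :
    Set (CStarSeminorm (FreeStarAlgebra X)) :=
  {q | (∀ x, q.toSeminorm (gen x) ≤ c x) ∧ ∀ r ∈ R, q.toSeminorm r = 0}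

lemma bddAbove_relSeminorms {X : Type u} (c : X → ℝ) (R : Set (FreeStarAlgebra X))
    (f : FreeStarAlgebra X) :
    BddAbove (Set.range fun q : relSeminorms c R => q.1.toSeminorm f) := by
  suffices h : ∃ C : ℝ, ∀ q ∈ relSeminorms c R, q.toSeminorm f ≤ C by
    obtain ⟨C, hC⟩ := h
    exact ⟨C, by rintro _ ⟨q, rfl⟩; exact hC q.1 q.2⟩
  induction f using MonoidAlgebra.induction_linear with
  | zero => exact ⟨0, fun q _ => (map_zero q.toSeminorm).le⟩
  | add f g hf hg =>
    obtain ⟨C, hC⟩ := hf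
    obtain ⟨D, hD⟩ := hg
    exact ⟨C + D, fun q hq => (map_add_le_add _ _ _).trans (add_le_add (hC q hq) (hD q hq))⟩
  | single w a =>
    suffices h : ∃ C : ℝ, ∀ q ∈ relSeminorms c R,
        q.toSeminorm (MonoidAlgebra.of ℂ (FreeMonoid (X × Bool)) w) ≤ C by
      obtain ⟨C, hC⟩ := h
      refine ⟨‖a‖ * C, fun q hq => ?_⟩
      have : (MonoidAlgebra.single w a : FreeStarAlgebra X) =
          a • MonoidAlgebra.of ℂ (FreeMonoid (X × Bool)) w := by
        simp [MonoidAlgebra.of_apply]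
      rw [this, map_smul_eq_mul]
      exact mul_le_mul_of_nonneg_left (hC q hq) (norm_nonneg a)
    induction w using FreeMonoid.inductionOn' with
    | one => exact ⟨1, fun q _ => by rw [map_one]; exact q.one_le⟩
    | of_mul l w ih =>
      obtain ⟨C, hC⟩ := ih
      refine ⟨c l.1 * C, fun q hq => ?_⟩
      rw [map_mul]
      have hl : q.toSeminorm (MonoidAlgebra.of ℂ (FreeMonoid (X × Bool)) (FreeMonoid.of l)) ≤
          c l.1 := by
        obtain ⟨x, b⟩ := l
        cases b
        · exact hq.1 x
        · rw [← star_gen, q.star_eq]; exact hq.1 x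
      exact (q.mul_le _ _).trans (mul_le_mul hl (hC q hq) (apply_nonneg _ _)
        ((apply_nonneg _ _).trans (hl)))

/-- The universal C*-seminorm for given relations and norm bounds. -/
def universalSeminorm {X : Type u} (c : X → ℝ) (R : Set (FreeStarAlgebra X)) :
    CStarSeminorm (FreeStarAlgebra X) :=
  CStarSeminorm.sup (relSeminorms c R) (bddAbove_relSeminorms c R)

/-- The universal unital C*-algebra generated by elements `x`, for `x : X`, with `‖x‖ ≤ c x`,
subject to the relations `r = 0`, for `r ∈ R`. -/
abbrev UniversalCStar {X : Type u} (c : X → ℝ) (R : Set (FreeStarAlgebra X)) : Type u :=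
  (universalSeminorm c R).Completion

lemma universal_rel {X : Type u} (c : X → ℝ) (R : Set (FreeStarAlgebra X))
    {r : FreeStarAlgebra X} (hr : r ∈ R) : (universalSeminorm c R).of r = 0 := by
  rw [← norm_eq_zero, CStarSeminorm.norm_of]
  change (⨆ q : relSeminorms c R, q.1.toSeminorm r) = 0
  have : ∀ q : relSeminorms c R, q.1.toSeminorm r = 0 := fun q => q.2.2 r hr
  simp [this]

/-! ### The full free product of two unital C*-algebras -/

section FreeProduct

variable (A : Type u) (B : Type v) [CStarAlgebra A] [CStarAlgebra B]

/-- The relations which say that `a ↦ f a` is a unital *-homomorphism. -/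
def homRelations {A : Type u} [CStarAlgebra A] {P : Type w} [Ring P] [StarRing P] [Algebra ℂ P]
    (f : A → P) : Set P :=
  {r | (∃ a a', r = f (a + a') - (f a + f a')) ∨ (∃ (c : ℂ) (a : A), r = f (c • a) - c • f a) ∨
    (∃ a a', r = f (a * a') - f a * f a') ∨ (∃ a, r = f (star a) - star (f a)) ∨ r = f 1 - 1}

/-- The relations of the free product: the two canonical maps are unital *-homomorphisms. -/
def freeProductRelations : Set (FreeStarAlgebra (A ⊕ B)) :=
  homRelations (fun a : A => gen (Sum.inl a)) ∪ homRelations (fun b : B => gen (Sum.inr b))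

/-- The full (unital) free product `A * B`: the universal C*-algebra generated by copies of the
unital C*-algebras `A` and `B`. The norm bounds are those which hold for any *-homomorphism. -/
def FreeProduct : Type (max u v) :=
  UniversalCStar (Sum.elim (fun a : A => ‖a‖) (fun b : B => ‖b‖)) (freeProductRelations A B)

instance : CStarAlgebra (FreeProduct A B) :=
  inferInstanceAs (CStarAlgebra (UniversalCStar _ (freeProductRelations A B)))

namespace FreeProduct

/-- The canonical map from the free *-algebra to the free product. -/
def mk : FreeStarAlgebra (A ⊕ B) →⋆ₐ[ℂ] FreeProduct A B :=
  (universalSeminorm (Sum.elim (fun a : A => ‖a‖) (fun b : B => ‖b‖))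
    (freeProductRelations A B)).of

variable {A B}

lemma mk_eq {x y : FreeStarAlgebra (A ⊕ B)} (h : x - y ∈ freeProductRelations A B) :
    mk A B x = mk A B y := by
  rw [← sub_eq_zero, ← map_sub]
  exact universal_rel _ _ h

/-- The canonical *-homomorphism `A → A * B`. -/
def inl : A →⋆ₐ[ℂ] FreeProduct A B where
  toFun a := mk A B (gen (Sum.inl a))
  map_one' := (mk_eq (Or.inl (by simp [homRelations]))).trans (map_one _)
  map_mul' a a' := (mk_eq (Or.inl (Or.inr (Or.inr (Or.inl ⟨a, a', rfl⟩))))).trans (map_mul _ _ _)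
  map_zero' := by
    have h := mk_eq (A := A) (B := B) (Or.inl (Or.inr (Or.inl ⟨0, 0, rfl⟩)))
    simpa using h
  map_add' a a' := (mk_eq (Or.inl (Or.inl ⟨a, a', rfl⟩))).trans (map_add _ _ _)
  commutes' c := by
    have h := mk_eq (A := A) (B := B) (Or.inl (Or.inr (Or.inl ⟨c, 1, rfl⟩)))
    have h1 : mk A B (gen (Sum.inl 1)) = 1 :=
      (mk_eq (Or.inl (by simp [homRelations]))).trans (map_one _)
    rw [Algebra.algebraMap_eq_smul_one, h, map_smul, h1, Algebra.algebraMap_eq_smul_one]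
  map_star' a :=
    (mk_eq (Or.inl (Or.inr (Or.inr (Or.inr (Or.inl ⟨a, rfl⟩)))))).trans (map_star _ _)

/-- The canonical *-homomorphism `B → A * B`. -/
def inr : B →⋆ₐ[ℂ] FreeProduct A B where
  toFun b := mk A B (gen (Sum.inr b))
  map_one' := (mk_eq (Or.inr (by simp [homRelations]))).trans (map_one _)
  map_mul' a a' := (mk_eq (Or.inr (Or.inr (Or.inr (Or.inl ⟨a, a', rfl⟩))))).trans (map_mul _ _ _)
  map_zero' := by
    have h := mk_eq (A := A) (B := B) (Or.inr (Or.inr (Or.inl ⟨0, 0, rfl⟩)))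
    simpa using h
  map_add' a a' := (mk_eq (Or.inr (Or.inl ⟨a, a', rfl⟩))).trans (map_add _ _ _)
  commutes' c := by
    have h := mk_eq (A := A) (B := B) (Or.inr (Or.inr (Or.inl ⟨c, 1, rfl⟩)))
    have h1 : mk A B (gen (Sum.inr 1)) = 1 :=
      (mk_eq (Or.inr (by simp [homRelations]))).trans (map_one _)
    rw [Algebra.algebraMap_eq_smul_one, h, map_smul, h1, Algebra.algebraMap_eq_smul_one]
  map_star' a :=
    (mk_eq (Or.inr (Or.inr (Or.inr (Or.inr (Or.inl ⟨a, rfl⟩)))))).trans (map_star _ _)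

end FreeProduct

end FreeProduct

/-! ### The minimal (spatial) tensor product -/

section MinTensor

variable {A : Type u} {B : Type v} [CStarAlgebra A] [CStarAlgebra B]

section Rep

variable {H : Type u} {K : Type v} [NormedAddCommGroup H] [InnerProductSpace ℂ H]
  [CompleteSpace H] [NormedAddCommGroup K] [InnerProductSpace ℂ K] [CompleteSpace K]

/-- The tensor product representation `a ⊗ b ↦ π a ⊗ ρ b`, by bounded operators on the algebraic
tensor product `H ⊗ K` with its inner product. (The norm of such an operator is the same as the
norm of its extension to the Hilbert space completion.) -/
def tensorRep (π : A →⋆ₐ[ℂ] (H →L[ℂ] H)) (ρ : B →⋆ₐ[ℂ] (K →L[ℂ] K)) :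
    A ⊗[ℂ] B →ₐ[ℂ] ((H ⊗[ℂ] K) →L[ℂ] (H ⊗[ℂ] K)) :=
  Algebra.TensorProduct.algHomOfLinearMapTensorProduct
    (TensorProduct.lift (LinearMap.mk₂ ℂ (fun a b => TensorProduct.mapL (π a) (ρ b))
      (fun a a' b => by rw [map_add, TensorProduct.mapL_add_left])
      (fun c a b => by rw [map_smul, TensorProduct.mapL_smul_left])
      (fun a b b' => by rw [map_add, TensorProduct.mapL_add_right])
      (fun c a b => by rw [map_smul, TensorProduct.mapL_smul_right])))
    (fun a a' b b' => by simp [TensorProduct.mapL_mul])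
    (by
      simp only [TensorProduct.lift.tmul, LinearMap.mk₂_apply, map_one]
      exact TensorProduct.mapL_id_id)

lemma tensorRep_tmul (π : A →⋆ₐ[ℂ] (H →L[ℂ] H)) (ρ : B →⋆ₐ[ℂ] (K →L[ℂ] K)) (a : A) (b : B) :
    tensorRep π ρ (a ⊗ₜ b) = TensorProduct.mapL (π a) (ρ b) := rfl

lemma tensorRep_inner (π : A →⋆ₐ[ℂ] (H →L[ℂ] H)) (ρ : B →⋆ₐ[ℂ] (K →L[ℂ] K))
    (t : A ⊗[ℂ] B) (x y : H ⊗[ℂ] K) :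
    inner ℂ (tensorRep π ρ (star t) x) y = inner ℂ x (tensorRep π ρ t y) := by
  induction t with
  | zero => simp
  | add t s ht hs => simp [inner_add_left, inner_add_right, ht, hs]
  | tmul a b =>
    rw [TensorProduct.star_tmul, tensorRep_tmul, tensorRep_tmul]
    induction x with
    | zero => simp
    | add x x' hx hx' => rw [map_add, inner_add_left, inner_add_left, hx, hx']
    | tmul h k =>
      induction y with
      | zero => simp
      | add y y' hy hy' => rw [map_add, inner_add_right, inner_add_right, hy, hy']
      | tmul h' k' =>
        rw [TensorProduct.mapL_tmul, TensorProduct.mapL_tmul, TensorProduct.inner_tmul,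
          TensorProduct.inner_tmul, map_star, map_star, ContinuousLinearMap.star_eq_adjoint,
          ContinuousLinearMap.star_eq_adjoint, ContinuousLinearMap.adjoint_inner_left,
          ContinuousLinearMap.adjoint_inner_left]

lemma tensorRep_norm_sq_le (π : A →⋆ₐ[ℂ] (H →L[ℂ] H)) (ρ : B →⋆ₐ[ℂ] (K →L[ℂ] K))
    (t : A ⊗[ℂ] B) :
    ‖tensorRep π ρ t‖ * ‖tensorRep π ρ t‖ ≤ ‖tensorRep π ρ (star t * t)‖ := by
  have h : ‖tensorRep π ρ t‖ ≤ √‖tensorRep π ρ (star t * t)‖ := by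
    refine ContinuousLinearMap.opNorm_le_bound _ (Real.sqrt_nonneg _) fun x => ?_
    have hN : 0 ≤ ‖tensorRep π ρ (star t * t)‖ := norm_nonneg (tensorRep π ρ (star t * t))
    rw [← Real.sqrt_sq (norm_nonneg x), ← Real.sqrt_mul hN]
    refine Real.le_sqrt_of_sq_le ?_
    have h1 : ‖tensorRep π ρ t x‖ ^ 2 = ‖inner ℂ (tensorRep π ρ (star t * t) x) x‖ := by
      have h2 : inner ℂ (tensorRep π ρ (star t * t) x) x =
          inner ℂ (tensorRep π ρ t x) (tensorRep π ρ t x) := by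
        rw [map_mul]; exact tensorRep_inner π ρ t (tensorRep π ρ t x) x
      rw [h2, sq, ← inner_self_eq_norm_mul_norm (𝕜 := ℂ) (tensorRep π ρ t x)]
      exact (inner_self_re_eq_norm (𝕜 := ℂ) (tensorRep π ρ t x))
    rw [h1]
    calc _ ≤ ‖tensorRep π ρ (star t * t) x‖ * ‖x‖ := norm_inner_le_norm _ _
      _ ≤ ‖tensorRep π ρ (star t * t)‖ * ‖x‖ * ‖x‖ := by
          gcongr; exact ContinuousLinearMap.le_opNorm _ _
      _ = _ := by ring
  calc _ ≤ √‖tensorRep π ρ (star t * t)‖ * √‖tensorRep π ρ (star t * t)‖ :=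
        mul_le_mul h h (norm_nonneg (tensorRep π ρ t)) (Real.sqrt_nonneg _)
    _ = _ := Real.mul_self_sqrt (norm_nonneg (tensorRep π ρ (star t * t)))

lemma tensorRep_norm_le_star (π : A →⋆ₐ[ℂ] (H →L[ℂ] H)) (ρ : B →⋆ₐ[ℂ] (K →L[ℂ] K))
    (t : A ⊗[ℂ] B) : ‖tensorRep π ρ t‖ ≤ ‖tensorRep π ρ (star t)‖ := by
  have h1 := tensorRep_norm_sq_le π ρ t
  rw [map_mul] at h1
  have h2 := h1.trans (norm_mul_le (tensorRep π ρ (star t)) (tensorRep π ρ t))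
  rcases (norm_nonneg (tensorRep π ρ t)).eq_or_lt with h | h
  · rw [← h]; exact norm_nonneg (tensorRep π ρ (star t))
  · exact le_of_mul_le_mul_right h2 h

/-- The C*-seminorm on the algebraic tensor product given by a pair of representations. -/
def repSeminorm (π : A →⋆ₐ[ℂ] (H →L[ℂ] H)) (ρ : B →⋆ₐ[ℂ] (K →L[ℂ] K)) :
    CStarSeminorm (A ⊗[ℂ] B) where
  toSeminorm := Seminorm.ofSMulLE (fun t => ‖tensorRep π ρ t‖)
    (by rw [map_zero]; exact norm_zero (E := (H ⊗[ℂ] K) →L[ℂ] (H ⊗[ℂ] K)))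
    (fun s t => by rw [map_add]; exact norm_add_le (tensorRep π ρ s) (tensorRep π ρ t))
    (fun c t => by
      rw [map_smul]; exact ContinuousLinearMap.opNorm_smul_le c (tensorRep π ρ t))
  mul_le' s t := by
    change ‖tensorRep π ρ (s * t)‖ ≤ ‖tensorRep π ρ s‖ * ‖tensorRep π ρ t‖
    rw [map_mul]; exact norm_mul_le (tensorRep π ρ s) (tensorRep π ρ t)
  star_mul_self' t := by
    change ‖tensorRep π ρ (star t * t)‖ = ‖tensorRep π ρ t‖ * ‖tensorRep π ρ t‖
    refine le_antisymm ?_ (tensorRep_norm_sq_le π ρ t)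
    rw [map_mul]
    refine (norm_mul_le (tensorRep π ρ (star t)) (tensorRep π ρ t)).trans
      (mul_le_mul_of_nonneg_right ?_ (norm_nonneg (tensorRep π ρ t)))
    simpa using tensorRep_norm_le_star π ρ (star t)

end Rep

variable (A B)

/-- The C*-seminorms on `A ⊗ B` coming from pairs of representations of `A` and of `B`. -/
def spatialSeminorms : Set (CStarSeminorm (A ⊗[ℂ] B)) :=
  {q | ∃ (H : Type u) (K : Type v) (_ : NormedAddCommGroup H) (_ : InnerProductSpace ℂ H)
    (_ : CompleteSpace H) (_ : NormedAddCommGroup K) (_ : InnerProductSpace ℂ K)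
    (_ : CompleteSpace K) (π : A →⋆ₐ[ℂ] (H →L[ℂ] H)) (ρ : B →⋆ₐ[ℂ] (K →L[ℂ] K)),
    q = repSeminorm π ρ}

lemma bddAbove_spatialSeminorms (t : A ⊗[ℂ] B) :
    BddAbove (Set.range fun q : spatialSeminorms A B => q.1.toSeminorm t) := by
  suffices h : ∃ C : ℝ, ∀ q ∈ spatialSeminorms A B, q.toSeminorm t ≤ C by
    obtain ⟨C, hC⟩ := h
    exact ⟨C, by rintro _ ⟨q, rfl⟩; exact hC q.1 q.2⟩
  induction t with
  | zero => exact ⟨0, fun q _ => (map_zero q.toSeminorm).le⟩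
  | add f g hf hg =>
    obtain ⟨C, hC⟩ := hf
    obtain ⟨D, hD⟩ := hg
    exact ⟨C + D, fun q hq => (map_add_le_add _ _ _).trans (add_le_add (hC q hq) (hD q hq))⟩
  | tmul a b =>
    refine ⟨‖a‖ * ‖b‖, ?_⟩
    rintro _ ⟨H, K, _, _, _, _, _, _, π, ρ, rfl⟩
    change ‖tensorRep π ρ (a ⊗ₜ b)‖ ≤ _
    rw [tensorRep_tmul]
    exact (TensorProduct.norm_mapL_le _ _).trans (mul_le_mul (NonUnitalStarAlgHom.norm_apply_le π a)
      (NonUnitalStarAlgHom.norm_apply_le ρ b) (norm_nonneg _) (norm_nonneg _))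

/-- The minimal (spatial) C*-norm on the algebraic tensor product: the supremum of the norms
`‖(π ⊗ ρ)(t)‖` over all pairs of representations. -/
def minSeminorm : CStarSeminorm (A ⊗[ℂ] B) :=
  CStarSeminorm.sup (spatialSeminorms A B) (bddAbove_spatialSeminorms A B)

/-- The minimal C*-tensor product of two unital C*-algebras. -/
abbrev MinTensor : Type (max u v) := (minSeminorm A B).Completion

end MinTensor

/-! ### Finitely generated Hopf algebras -/

section Hopf

variable {n : ℕ} {A : Type u} [CStarAlgebra A] {B : Type v} [CStarAlgebra B]

/-- The *-algebra generated by the entries of `u` (the dense *-subalgebra `A_s`). -/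
def coeffAlgebra (u : Matrix (Fin n) (Fin n) A) : StarSubalgebra ℂ A :=
  StarAlgebra.adjoin ℂ (Set.range fun p : Fin n × Fin n => u p.1 p.2)

lemma mem_coeffAlgebra (u : Matrix (Fin n) (Fin n) A) (i j : Fin n) : u i j ∈ coeffAlgebra u :=
  StarAlgebra.subset_adjoin ℂ _ ⟨(i, j), rfl⟩

/-- The C*-algebra generated by the entries of `u`. -/
def coeffCStarAlgebra (u : Matrix (Fin n) (Fin n) A) : StarSubalgebra ℂ A :=
  (coeffAlgebra u).topologicalClosure

/-- `(A, u)` is a finitely generated Hopf algebra. The antipode, being antimultiplicative, is a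
morphism to the opposite algebra. -/
structure IsHopf (u : Matrix (Fin n) (Fin n) A) : Prop where
  unitary : u ∈ unitary (Matrix (Fin n) (Fin n) A)
  generates : coeffCStarAlgebra u = ⊤
  comul : ∃ Δ : A →⋆ₐ[ℂ] MinTensor A A,
    ∀ i j, Δ (u i j) = (minSeminorm A A).of (∑ k, u i k ⊗ₜ[ℂ] u k j)
  counit : ∃ ε : A →⋆ₐ[ℂ] ℂ, ∀ i j, ε (u i j) = if i = j then 1 else 0
  antipode : ∃ S : A →⋆ₐ[ℂ] Aᵐᵒᵖ, ∀ i j, S (u i j) = MulOpposite.op (star (u j i))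

/-- There is a morphism `(A, u) → (B, v)`: a morphism of *-algebras `A_s → B_s` between the dense
*-subalgebras, mapping `u_ij` to `v_ij`. -/
def HasMorphism (u : Matrix (Fin n) (Fin n) A) (v : Matrix (Fin n) (Fin n) B) : Prop :=
  ∃ f : coeffAlgebra u →⋆ₐ[ℂ] coeffAlgebra v,
    ∀ i j, f ⟨u i j, mem_coeffAlgebra u i j⟩ = ⟨v i j, mem_coeffAlgebra v i j⟩

/-- The conjugate matrix `ū`, with entries `u_ij*`. -/
def conj (u : Matrix (Fin n) (Fin n) A) : Matrix (Fin n) (Fin n) A := u.map star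

/-- The tensor power `u^α`, for a word `α` in the letters `a = false` and `b = true`, where
`u^a = u` and `u^b = ū`. -/
def tensorPow (u : Matrix (Fin n) (Fin n) A) (α : List Bool) :
    Matrix (Fin α.length → Fin n) (Fin α.length → Fin n) A :=
  fun i j => (List.ofFn fun r : Fin α.length =>
    bif α.get r then conj u (i r) (j r) else u (i r) (j r)).prod

/-- The space `Hom(u^α, u^β)` of scalar matrices `T` with `T u^α = u^β T`. -/
def Hom (u : Matrix (Fin n) (Fin n) A) (α β : List Bool) :
    Submodule ℂ (Matrix (Fin β.length → Fin n) (Fin α.length → Fin n) ℂ) where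
  carrier := {T | T.map (algebraMap ℂ A) * tensorPow u α = tensorPow u β * T.map (algebraMap ℂ A)}
  zero_mem' := by simp
  add_mem' {S T} hS hT := by
    simp only [Set.mem_ofPred_eq] at *
    rw [Matrix.map_add _ (map_add _), Matrix.add_mul, Matrix.mul_add, hS, hT]
  smul_mem' c T hT := by
    simp only [Set.mem_ofPred_eq] at *
    have h : (c • T).map (algebraMap ℂ A) = c • T.map (algebraMap ℂ A) := by
      ext i j
      simp [Algebra.smul_def]
    rw [h, Matrix.smul_mul, Matrix.mul_smul, hT]

end Hopf

/-! ### The universal algebras `A_u(n)` and `A_s(n)` -/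

section Universal

variable (n : ℕ)

/-- The matrix of generators of the free *-algebra on `n²` elements. -/
def genMatrix : Matrix (Fin n) (Fin n) (FreeStarAlgebra (Fin n × Fin n)) :=
  fun i j => gen (i, j)

variable {n} in
/-- The set of entries of a matrix. -/
def entries {P : Type u} (M : Matrix (Fin n) (Fin n) P) : Set P :=
  Set.range fun p : Fin n × Fin n => M p.1 p.2

/-- The relations which say that `u` and its transpose `uᵗ` are unitaries. -/
def biunitaryRelations : Set (FreeStarAlgebra (Fin n × Fin n)) :=
  let U := genMatrix n
  entries (U * U.conjTranspose - 1) ∪ entries (U.conjTranspose * U - 1) ∪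
    entries (U.transpose * U.transpose.conjTranspose - 1) ∪
    entries (U.transpose.conjTranspose * U.transpose - 1)

/-- The relations which say that `u` is magic: orthogonal (`u = ū` and `uᵗ = u⁻¹`), with `ab = 0`
for distinct entries `a, b` on the same row or column, and with entries which are projections. -/
def magicRelations : Set (FreeStarAlgebra (Fin n × Fin n)) :=
  let U := genMatrix n
  entries (U - U.map star) ∪ entries (U * U.transpose - 1) ∪ entries (U.transpose * U - 1) ∪
    {r | ∃ i j k, j ≠ k ∧ r = U i j * U i k} ∪ {r | ∃ i j k, i ≠ k ∧ r = U i j * U k j} ∪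
    {r | ∃ i j, r = U i j * U i j - U i j}

/-- The algebra `A_u(n)`: the universal C*-algebra generated by the entries of an `n × n`
biunitary matrix (these entries have norm at most `1`). -/
abbrev Au : Type := UniversalCStar (fun _ : Fin n × Fin n => (1 : ℝ)) (biunitaryRelations n)

/-- The fundamental matrix of `A_u(n)`. -/
def uMatrix : Matrix (Fin n) (Fin n) (Au n) :=
  (genMatrix n).map (universalSeminorm (fun _ => (1 : ℝ)) (biunitaryRelations n)).of

/-- The algebra `A_s(n)`: the universal C*-algebra generated by the entries of an `n × n`
magic matrix (these entries have norm at most `1`). -/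
abbrev As : Type := UniversalCStar (fun _ : Fin n × Fin n => (1 : ℝ)) (magicRelations n)

/-- The fundamental matrix of `A_s(n)`. -/
def sMatrix : Matrix (Fin n) (Fin n) (As n) :=
  (genMatrix n).map (universalSeminorm (fun _ => (1 : ℝ)) (magicRelations n)).of

end Universal

/-! ### Diagrams -/

/-- The position of a point on the boundary of the box: the upper row is read from left to right,
and then the lower row from right to left. -/
def position {k l : ℕ} : Fin (2 * k) ⊕ Fin (2 * l) → ℕ
  | Sum.inl x => x
  | Sum.inr y => 2 * k + 2 * l - 1 - y

/-- The diagrams `D_s(k, l)`: noncrossing pairings between an upper row of `2k` points, and a lower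
row of `2l` points. The map `σ` sends a point to the other endpoint of its string. -/
structure Diagram (k l : ℕ) where
  σ : Fin (2 * k) ⊕ Fin (2 * l) → Fin (2 * k) ⊕ Fin (2 * l)
  involutive : Function.Involutive σ
  ne : ∀ x, σ x ≠ x
  noncrossing : ∀ x y, ¬ (position x < position y ∧ position y < position (σ x) ∧
    position (σ x) < position (σ y))

/-- The index carried by a point, the indices `i` of the upper legs and `j` of the lower legs being
doubled: the points `2r` and `2r + 1` both belong to the leg `r`. -/
def pointIndex {k l n : ℕ} (i : Fin k → Fin n) (j : Fin l → Fin n) :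
    Fin (2 * k) ⊕ Fin (2 * l) → Fin n
  | Sum.inl x => i ⟨x / 2, by omega⟩
  | Sum.inr y => j ⟨y / 2, by omega⟩

open Classical in
/-- The linear map `(ℂⁿ)^{⊗k} → (ℂⁿ)^{⊗l}` given by a diagram: its `(j, i)` entry is `1` if each
string joins points carrying equal indices, and `0` otherwise. -/
def Diagram.toMatrix (n : ℕ) {k l : ℕ} (d : Diagram k l) :
    Matrix (Fin l → Fin n) (Fin k → Fin n) ℂ :=
  fun j i => if ∀ x, pointIndex i j (d.σ x) = pointIndex i j x then 1 else 0

/-! ### Freeness, level, free complexification -/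

section Free

variable {n : ℕ} {A : Type u} [CStarAlgebra A]

/-- The finitely generated Hopf algebra `(A, u)` is free: the canonical map `A_u(n) → A_s(n)`
factorizes through `A`, and the spaces `Hom(u^α, u^β)` are spanned by diagrams. -/
structure IsFree (u : Matrix (Fin n) (Fin n) A) : Prop where
  hopf : IsHopf u
  from_Au : HasMorphism (uMatrix n) u
  to_As : HasMorphism u (sMatrix n)
  span_diagrams : ∀ α β : List Bool, ∃ D : Set (Diagram α.length β.length),
    Hom u α β = Submodule.span ℂ (Diagram.toMatrix n '' D)

/-- Free orthogonal means free, with `u = ū`. -/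
structure IsFreeOrthogonal (u : Matrix (Fin n) (Fin n) A) : Prop where
  free : IsFree u
  conj_eq : conj u = u

/-- The level: the smallest `l ∈ {0, 1, …, ∞}` such that `1 ∈ u^{⊗2l+1}`, i.e. such that the space
`Hom(1, u^{⊗2l+1})` is nonzero. -/
def level (u : Matrix (Fin n) (Fin n) A) : ℕ∞ :=
  sInf {l : ℕ∞ | ∃ m : ℕ, l = m ∧ Hom u [] (List.replicate (2 * m + 1) false) ≠ ⊥}

/-- The identity function `z : 𝕋 → ℂ`. -/
def circleId : C(Circle, ℂ) := ⟨fun x => (x : ℂ), by fun_prop⟩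

/-- The matrix `ũ = zu`, with entries in the full free product `C(𝕋) * A`. -/
def complexifiedMatrix (u : Matrix (Fin n) (Fin n) A) :
    Matrix (Fin n) (Fin n) (FreeProduct C(Circle, ℂ) A) :=
  fun i j => FreeProduct.inl circleId * FreeProduct.inr (u i j)

/-- The free complexification `Ã ⊂ C(𝕋) * A`: the C*-algebra generated by the entries of
`ũ = zu`. -/
def freeComplexification (u : Matrix (Fin n) (Fin n) A) :
    StarSubalgebra ℂ (FreeProduct C(Circle, ℂ) A) :=
  coeffCStarAlgebra (complexifiedMatrix u)

end Free

end FreeQG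

end

/-! The whole theorem reduces to showing that `z` lies in `Ã`. Since `u = ū`, the alternating
product `(z u_{i₁j₁}) (z u_{i₂j₂})* (z u_{i₃j₃}) ⋯` with an odd number of factors telescopes: each
starred factor ends in `z*`, which cancels the `z` of the next one, so `z` times any odd product of
entries of `u` lies in `Ã` (`circleId_mul_prod_mem`). Finite level provides a nonzero vector `T`
fixed by some odd tensor power of `u`. Reading `T = u^{⊗2m+1} T` at a nonzero coordinate and
dividing by it writes `1` as a linear combination of odd products of entries. Multiplying by `z` on
the left puts `z` in `Ã` (`circleId_mem_of_hom_ne_bot`). Then `u_ij = z* (z u_ij)` is in `Ã` too. As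
`Ã` is closed, it contains both factors of the free product, hence everything
(`freeComplexification_eq_top_of_circleId_mem`). -/

namespace FreeQG

universe u v

open FreeStarAlgebra

/-! ### Generation of `C(𝕋)` and of the free product. -/

/-- A closed *-subalgebra contains the image of a *-homomorphism as soon as it contains the image
of a set which generates a dense *-subalgebra. -/
lemma map_mem_of_topologicalClosure_adjoin_eq_top {A : Type u} {B : Type v} [CStarAlgebra A]
    [CStarAlgebra B] (f : A →⋆ₐ[ℂ] B) {s : Set A} {S : StarSubalgebra ℂ B}
    (hs : (StarAlgebra.adjoin ℂ s).topologicalClosure = ⊤) (hS : IsClosed (S : Set B))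
    (h : ∀ a ∈ s, f a ∈ S) (a : A) : f a ∈ S := by
  have hf : Continuous f :=
    AddMonoidHomClass.continuous_of_bound f 1 fun x => by
      rw [one_mul]; exact NonUnitalStarAlgHom.norm_apply_le f x
  -- `f` is contractive, so the preimage of `S` is a closed *-subalgebra containing `s`.
  have hle : (StarAlgebra.adjoin ℂ s).topologicalClosure ≤ S.comap f :=
    StarSubalgebra.topologicalClosure_minimal (StarAlgebra.adjoin_le h) (hS.preimage hf)
  rw [hs] at hle
  exact hle (StarSubalgebra.mem_top (x := a))

/-- Stone–Weierstrass: the function `z` alone separates the points of the compact space `𝕋`. -/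
lemma topologicalClosure_adjoin_circleId :
    (StarAlgebra.adjoin ℂ {circleId}).topologicalClosure = ⊤ := by
  refine ContinuousMap.starSubalgebra_topologicalClosure_eq_top_of_separatesPoints _ ?_
  intro x y hxy
  exact ⟨circleId, ⟨circleId, StarAlgebra.self_mem_adjoin_singleton ℂ circleId, rfl⟩,
    fun h => hxy (Circle.ext h)⟩

lemma star_circleId_mul_self : star circleId * circleId = 1 := by
  ext x
  change (starRingEnd ℂ) (x : ℂ) * x = 1
  rw [← Complex.normSq_eq_conj_mul_self, Circle.normSq_coe, Complex.ofReal_one]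

namespace FreeProduct

variable {A : Type u} {B : Type v} [CStarAlgebra A] [CStarAlgebra B]

/-- This is the cancellation `z* z = 1` behind both the telescoping of odd products and the recovery
of `u_ij` from `z u_ij`. -/
lemma star_inl_circleId_mul_self :
    star (inl circleId : FreeProduct C(Circle, ℂ) A) * inl circleId = 1 := by
  rw [← map_star, ← map_mul, star_circleId_mul_self, map_one]

/-- The full free product is generated, as a C*-algebra, by the two factors. -/
lemma eq_top_of_mem {S : StarSubalgebra ℂ (FreeProduct A B)}
    (hS : IsClosed (S : Set (FreeProduct A B))) (hl : ∀ a : A, inl a ∈ S)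
    (hr : ∀ b : B, inr b ∈ S) : S = ⊤ := by
  have hgen : ∀ x : A ⊕ B, mk A B (gen x) ∈ S := by
    rintro (a | b)
    exacts [hl a, hr b]
  -- By linearity it is enough to treat words; each letter is a generator or the adjoint of one.
  have hmk : ∀ f, mk A B f ∈ S := by
    intro f
    induction f using MonoidAlgebra.induction_linear with
    | zero => rw [map_zero]; exact zero_mem S
    | add f g hf hg => rw [map_add]; exact add_mem hf hg
    | single w c =>
      have hc : (MonoidAlgebra.single w c : FreeStarAlgebra (A ⊕ B)) =
          c • MonoidAlgebra.of ℂ _ w := by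
        simp [MonoidAlgebra.of_apply]
      rw [hc, map_smul]
      refine SMulMemClass.smul_mem c ?_
      induction w using FreeMonoid.inductionOn' with
      | one => rw [map_one, map_one]; exact one_mem S
      | of_mul l w ih =>
        rw [map_mul, map_mul]
        -- The equation `hc` depends on the word, so the induction hypothesis asks for it again for
        -- the shorter word.
        refine mul_mem ?_ (ih (by simp [MonoidAlgebra.of_apply]))
        obtain ⟨x, _ | _⟩ := l
        · exact hgen x
        · rw [← star_gen, map_star]
          exact star_mem (hgen x)
  rw [eq_top_iff]
  intro x _
  -- The free product is by definition a Hausdorff completion of the free *-algebra, so the image of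
  -- `mk` is dense and the closed set `S` is everything.
  exact (CStarSeminorm.denseRange_of (universalSeminorm (Sum.elim (fun a : A => ‖a‖)
    (fun b : B => ‖b‖)) (freeProductRelations A B))).induction_on
    (p := fun x : FreeProduct A B => x ∈ S) x hS hmk

end FreeProduct

open FreeProduct

variable {n : ℕ} {A : Type u} [CStarAlgebra A] {u : Matrix (Fin n) (Fin n) A}

/-! ### Odd products of entries, multiplied by `z`. -/

lemma complexifiedMatrix_mem (i j : Fin n) :
    inl circleId * inr (u i j) ∈ freeComplexification u :=
  StarSubalgebra.le_topologicalClosure _ (mem_coeffAlgebra (complexifiedMatrix u) i j)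

/-- If `u = ū`, then a product of an odd number of entries of `u`, multiplied by `z`, is the product
`(z u_{i₁j₁}) (z u_{i₂j₂})* (z u_{i₃j₃}) ⋯` and so belongs to `Ã`. -/
lemma circleId_mul_prod_mem (hu : conj u = u) (m : ℕ) :
    ∀ L : List A, L.length = 2 * m + 1 → (∀ a ∈ L, ∃ i j, a = u i j) →
      inl circleId * inr L.prod ∈ freeComplexification u := by
  induction m with
  | zero =>
    intro L hL h
    obtain ⟨a, rfl⟩ := List.length_eq_one_iff.1 hL
    obtain ⟨i, j, rfl⟩ := h a (by simp)
    rw [List.prod_singleton]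
    exact complexifiedMatrix_mem i j
  | succ m ih =>
    intro L hL h
    match L, hL, h with
    -- The length is `2 * (m + 1) + 1 ≥ 3`, so two letters can be removed without changing the
    -- parity.
    | a :: b :: L, hL, h =>
      obtain ⟨i, j, rfl⟩ := h a (by simp)
      obtain ⟨k, l, rfl⟩ := h b (by simp)
      have hstar : star (u k l) = u k l := congrFun (congrFun hu k) l
      have hrec := ih L (by simp at hL; omega) fun a ha => h a (by simp [ha])
      -- The middle factor is `u_kl* z* = u_kl z*`, and its `z*` meets the `z` that the induction
      -- hypothesis keeps in front of the remaining product.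
      have key : (inl circleId * inr (u i j)) * star (inl circleId * inr (u k l)) *
          (inl circleId * inr L.prod) =
          (inl circleId * inr (u i j :: u k l :: L).prod : FreeProduct C(Circle, ℂ) A) := by
        rw [star_mul, ← map_star inr, hstar, List.prod_cons, List.prod_cons, map_mul, map_mul]
        simp only [mul_assoc]
        rw [← mul_assoc (star (inl circleId)) (inl circleId), star_inl_circleId_mul_self, one_mul]
      rw [← key]
      exact mul_mem (mul_mem (complexifiedMatrix_mem i j) (star_mem (complexifiedMatrix_mem k l)))
        hrec

lemma circleId_mul_tensorPow_mem (hu : conj u = u) (m : ℕ)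
    (i j : Fin (List.replicate (2 * m + 1) false).length → Fin n) :
    inl circleId * inr (tensorPow u (List.replicate (2 * m + 1) false) i j) ∈
      freeComplexification u := by
  refine circleId_mul_prod_mem hu m _ (by simp) fun a ha => ?_
  obtain ⟨r, rfl⟩ := (List.mem_ofFn' _ _).1 ha
  -- Both branches of the `bif` in `tensorPow` agree once `ū = u`.
  exact ⟨i r, j r, by simp only [hu, Bool.cond_self]⟩

/-! ### From a fixed vector to `z`, and from `z` to the whole free product. -/

/-- A nonzero fixed vector of an odd tensor power of `u = ū` forces `z ∈ Ã`. -/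
lemma circleId_mem_of_hom_ne_bot (hu : conj u = u) {m : ℕ}
    (h : Hom u [] (List.replicate (2 * m + 1) false) ≠ ⊥) :
    inl circleId ∈ freeComplexification u := by
  obtain ⟨T, hT, hT0⟩ := Submodule.exists_mem_ne_zero_of_ne_bot h
  obtain ⟨i, e, hie⟩ : ∃ i e, T i e ≠ 0 := by
    by_contra! h0
    exact hT0 (Matrix.ext h0)
  have hfix : T.map (algebraMap ℂ A) * tensorPow u [] =
      tensorPow u (List.replicate (2 * m + 1) false) * T.map (algebraMap ℂ A) := hT
  have heq := congrFun (congrFun hfix i) e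
  have : IsEmpty (Fin ([] : List Bool).length) := Fin.isEmpty
  have : Unique (Fin ([] : List Bool).length → Fin n) := Pi.uniqueOfIsEmpty _
  -- The tensor power of the empty word is a `1 × 1` matrix whose entry is an empty product. Thus
  -- `T` is a single column, and `heq` becomes `T_ie = ∑_j (u^{⊗2m+1})_ij T_je`.
  have hone : tensorPow u [] default e = 1 := rfl
  rw [Matrix.mul_apply, Matrix.mul_apply, Fintype.sum_unique, hone, mul_one,
    Subsingleton.elim default e] at heq
  have hmem : T i e • (inl circleId : FreeProduct C(Circle, ℂ) A) ∈ freeComplexification u := by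
    -- This is the fixed-vector equation multiplied by `z` on the left, with the scalars moved out.
    have hsum : T i e • (inl circleId : FreeProduct C(Circle, ℂ) A) =
        ∑ j, T j e • (inl circleId *
          inr (tensorPow u (List.replicate (2 * m + 1) false) i j)) := by
      calc T i e • (inl circleId : FreeProduct C(Circle, ℂ) A)
          = inl circleId * inr (T.map (algebraMap ℂ A) i e) := by
            rw [Matrix.map_apply, Algebra.algebraMap_eq_smul_one, map_smul, map_one,
              mul_smul_comm, mul_one]
        _ = _ := by
            rw [heq, map_sum, Finset.mul_sum]
            refine Finset.sum_congr rfl fun j _ => ?_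
            rw [Matrix.map_apply, Algebra.algebraMap_eq_smul_one, mul_smul_comm, mul_one,
              map_smul, mul_smul_comm]
    rw [hsum]
    exact sum_mem fun j _ => SMulMemClass.smul_mem _ (circleId_mul_tensorPow_mem hu m i j)
  simpa [smul_smul, inv_mul_cancel₀ hie] using SMulMemClass.smul_mem (T i e)⁻¹ hmem

/-- Once `z` is available, `z* (z u_ij) = u_ij`, so `Ã` contains topological generators of both
factors. -/
lemma freeComplexification_eq_top_of_circleId_mem (hgen : coeffCStarAlgebra u = ⊤)
    (hz : inl circleId ∈ freeComplexification u) : freeComplexification u = ⊤ := by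
  have hclosed : IsClosed (freeComplexification u : Set (FreeProduct C(Circle, ℂ) A)) :=
    StarSubalgebra.isClosed_topologicalClosure _
  refine eq_top_of_mem hclosed
    (map_mem_of_topologicalClosure_adjoin_eq_top inl topologicalClosure_adjoin_circleId hclosed ?_)
    (map_mem_of_topologicalClosure_adjoin_eq_top inr hgen hclosed ?_)
  · rintro _ rfl
    exact hz
  · rintro _ ⟨⟨i, j⟩, rfl⟩
    have h := mul_mem (star_mem hz) (complexifiedMatrix_mem (u := u) i j)
    rwa [← mul_assoc, star_inl_circleId_mul_self, one_mul] at h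

end FreeQG

/-- A free orthogonal Hopf algebra of finite level satisfies `Ã = C(𝕋) * A`. -/
theorem theorem4p4 {n : ℕ} {A : Type*} [CStarAlgebra A] (u : Matrix (Fin n) (Fin n) A)
    (hu : FreeQG.IsFreeOrthogonal u) (hlevel : FreeQG.level u < ⊤) :
    FreeQG.freeComplexification u = ⊤ := by
  -- An infimum below `⊤` forces the set of admissible exponents to be nonempty. Any member `m` will
  -- do; its minimality plays no role.
  obtain ⟨_, ⟨m, _, hm⟩, _⟩ := sInf_lt_iff.1 hlevel
  exact FreeQG.freeComplexification_eq_top_of_circleId_mem hu.free.hopf.generates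
    (FreeQG.circleId_mem_of_hom_ne_bot hu.conj_eq hm)
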